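/- All Banach spaces are real. Let $M$ be a complete metric space with a distinguished point $0\in M$. For a Banach space $Z$, let $\mathrm{Lip}_0(M,Z)$ be the space of all Lipschitz maps $F\colon M\to Z$ with $F(0)=0$, endowed with the norm \[\|F\|_L=\sup\Big\{\tfrac{\|F(p)-F(q)\|}{d(p,q)} : p,q\in M,\ p\neq q\Big\}.\] A map $F\in \mathrm{Lip}_0(M,Z)$ is Lipschitz compact if the set $\big\{\tfrac{F(p)-F(q)}{d(p,q)} : p\ne q\big\}$ is relatively compact in $Z$, and it strongly attains its norm if $\|F(p)-F(q)\|/d(p,q)=\|F\|_L$ for some $p\neq q$ in $M$. Let $\mathrm{Lip}_K(M,Z)$ be the set of Lipschitz compact maps in $\mathrm{Lip}_0(M,Z)$, and let $\mathrm{SA}_K(M,Z)$ be the set of those $F\in\mathrm{Lip}_K(M,Z)$ that strongly attain their norm. Density is understood with respect to $\|\cdot\|_L$. Let $Y$ be a Banach space such that $\mathrm{SA}_K(M,Y)$ is dense in $\mathrm{Lip}_K(M,Y)$. Then: (1) For every compact Hausdorff space $K$, $\mathrm{SA}_K(M,C(K,Y))$ is dense in $\mathrm{Lip}_K(M,C(K,Y))$.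 (2) For every $1\le p<\infty$, if $\mathrm{SA}_K(M,\ell_p(Y))$ is dense in $\mathrm{Lip}_K(M,\ell_p(Y))$, then $\mathrm{SA}_K(M,L_p(\mu,Y))$ is dense in $\mathrm{Lip}_K(M,L_p(\mu,Y))$ for every positive measure $\mu$. (3) For every $\sigma$-finite positive measure $\mu$, $\mathrm{SA}_K(M,L_\infty(\mu,Y))$ is dense in $\mathrm{Lip}_K(M,L_\infty(\mu,Y))$. Here $C(K,Y)$ carries the supremum norm, $\ell_p(Y)$ is the space of $p$-summable sequences in $Y$, and $L_p(\mu,Y)$, $L_\infty(\mu,Y)$ are the Lebesgue–Bochner spaces of (classes of) strongly measurable functions. -/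

import Mathlib

open MeasureTheory
open scoped ENNReal NNReal

noncomputable section

namespace PointedLip

variable {M : Type*} [MetricSpace M] (o : M)
variable (Y : Type*) [NormedAddCommGroup Y] [NormedSpace ℝ Y]

/-- The vector space of Lipschitz maps from the pointed metric space `(M, o)` to `Y` that vanish
at the base point `o`, as a linear subspace of all maps. -/
def lipSubmodule : Submodule ℝ (M → Y) where
  carrier := {F | (∃ C : ℝ≥0, LipschitzWith C F) ∧ F o = 0}
  zero_mem' := ⟨⟨0, LipschitzWith.const 0⟩, rfl⟩
  add_mem' := by
    rintro F G ⟨⟨C, hF⟩, hF0⟩ ⟨⟨D, hG⟩, hG0⟩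
    exact ⟨⟨C + D, hF.add hG⟩, by simp [hF0, hG0]⟩
  smul_mem' := by
    rintro c F ⟨⟨C, hF⟩, hF0⟩
    refine ⟨⟨‖c‖₊ * C, LipschitzWith.of_dist_le_mul fun p q => ?_⟩, by simp [hF0]⟩
    rw [Pi.smul_apply, Pi.smul_apply, dist_smul₀, NNReal.coe_mul, coe_nnnorm, mul_assoc]
    exact mul_le_mul_of_nonneg_left (hF.dist_le_mul p q) (norm_nonneg c)

/-- `Lip₀(M, Y)` as a type of its own (so that it carries the Lipschitz norm only, and not the
topology of pointwise convergence). -/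
def Lip0 : Type _ := ↥(lipSubmodule o Y)

namespace Lip0

instance : AddCommGroup (Lip0 o Y) := inferInstanceAs (AddCommGroup ↥(lipSubmodule o Y))

instance : Module ℝ (Lip0 o Y) := inferInstanceAs (Module ℝ ↥(lipSubmodule o Y))

instance : CoeFun (Lip0 o Y) (fun _ => M → Y) := ⟨fun F => F.1⟩

variable {o Y}

/-- The set of all slopes `‖F p - F q‖ / d(p, q)` over pairs of distinct points. -/
def slopes (F : Lip0 o Y) : Set ℝ :=
  {r | ∃ p q : M, p ≠ q ∧ r = ‖F p - F q‖ / dist p q}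

/-- The Lipschitz norm: the supremum of the slopes (`0` if `M` has only one point). -/
instance : Norm (Lip0 o Y) := ⟨fun F => sSup (slopes F)⟩

theorem norm_def (F : Lip0 o Y) : ‖F‖ = sSup (slopes F) := rfl

@[simp] theorem coe_zero (p : M) : (0 : Lip0 o Y) p = 0 := rfl

@[simp] theorem coe_add (F G : Lip0 o Y) (p : M) : (F + G) p = F p + G p := rfl

@[simp] theorem coe_neg (F : Lip0 o Y) (p : M) : (-F) p = -F p := rfl

@[simp] theorem coe_sub (F G : Lip0 o Y) (p : M) : (F - G) p = F p - G p := rfl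

@[simp] theorem coe_smul (c : ℝ) (F : Lip0 o Y) (p : M) : (c • F) p = c • F p := rfl

theorem coe_base (F : Lip0 o Y) : F o = 0 := F.2.2

theorem ext_coe {F G : Lip0 o Y} (h : ∀ p, F p = G p) : F = G := Subtype.ext (funext h)

theorem bddAbove_slopes (F : Lip0 o Y) : BddAbove (slopes F) := by
  obtain ⟨C, hC⟩ := F.2.1
  refine ⟨C, ?_⟩
  rintro r ⟨p, q, hpq, rfl⟩
  rw [div_le_iff₀ (dist_pos.2 hpq), ← dist_eq_norm]
  exact hC.dist_le_mul p q

theorem norm_nonneg' (F : Lip0 o Y) : 0 ≤ ‖F‖ := by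
  refine Real.sSup_nonneg ?_
  rintro r ⟨p, q, -, rfl⟩
  positivity

theorem norm_sub_le_mul (F : Lip0 o Y) (p q : M) : ‖F p - F q‖ ≤ ‖F‖ * dist p q := by
  rcases eq_or_ne p q with rfl | hpq
  · simp
  · rw [← div_le_iff₀ (dist_pos.2 hpq)]
    exact le_csSup (bddAbove_slopes F) ⟨p, q, hpq, rfl⟩

theorem norm_le_of (F : Lip0 o Y) {c : ℝ} (hc : 0 ≤ c)
    (h : ∀ p q : M, ‖F p - F q‖ ≤ c * dist p q) : ‖F‖ ≤ c := by
  refine Real.sSup_le ?_ hc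
  rintro r ⟨p, q, hpq, rfl⟩
  rw [div_le_iff₀ (dist_pos.2 hpq)]
  exact h p q

theorem norm_smul_le' (c : ℝ) (F : Lip0 o Y) : ‖c • F‖ ≤ |c| * ‖F‖ := by
  refine norm_le_of _ (mul_nonneg (abs_nonneg c) (norm_nonneg' F)) fun p q => ?_
  rw [coe_smul, coe_smul, ← smul_sub, norm_smul, Real.norm_eq_abs, mul_assoc]
  exact mul_le_mul_of_nonneg_left (norm_sub_le_mul F p q) (abs_nonneg c)

instance : NormedAddCommGroup (Lip0 o Y) :=
  AddGroupNorm.toNormedAddCommGroup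
    { toFun := fun F => ‖F‖
      map_zero' := le_antisymm (norm_le_of _ le_rfl (by simp)) (norm_nonneg' _)
      add_le' := fun F G => by
        refine norm_le_of _ (add_nonneg (norm_nonneg' F) (norm_nonneg' G)) fun p q => ?_
        have h : (F + G) p - (F + G) q = (F p - F q) + (G p - G q) := by
          rw [coe_add, coe_add]; abel
        rw [h, add_mul]
        exact (norm_add_le _ _).trans
          (add_le_add (norm_sub_le_mul F p q) (norm_sub_le_mul G p q))
      neg' := fun F => by
        have key : ∀ G : Lip0 o Y, ‖-G‖ ≤ ‖G‖ := fun G => by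
          simpa using norm_smul_le' (-1) G
        exact le_antisymm (key F) (by simpa using key (-F))
      eq_zero_of_map_eq_zero' := fun F hF => by
        refine ext_coe fun p => ?_
        have h := norm_sub_le_mul F p o
        rw [show ‖F‖ = 0 from hF, zero_mul, coe_base, sub_zero] at h
        exact norm_le_zero_iff.1 h }

instance : NormedSpace ℝ (Lip0 o Y) where
  norm_smul_le := norm_smul_le'

/-- The Lipschitz image `{(F p - F q) / d(p, q) : p ≠ q}` of `F`, a subset of `Y`. -/
def lipschitzImage (F : Lip0 o Y) : Set Y :=
  {y | ∃ p q : M, p ≠ q ∧ y = (dist p q)⁻¹ • (F p - F q)}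

/-- `F` strongly attains its norm: the supremum defining `‖F‖` is a maximum. -/
def StronglyAttains (F : Lip0 o Y) : Prop :=
  ∃ p q : M, p ≠ q ∧ ‖F p - F q‖ / dist p q = ‖F‖

/-- `F` is Lipschitz compact: its Lipschitz image is relatively compact in `Y`. -/
def IsLipschitzCompact (F : Lip0 o Y) : Prop :=
  IsCompact (closure (lipschitzImage F))

end Lip0

/-- `SA(M, Y)`: the strongly norm attaining Lipschitz maps. -/
def SA : Set (Lip0 o Y) := {F | F.StronglyAttains}

/-- `Lip_K(M, Y)`: the Lipschitz compact maps. -/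
def LipK : Set (Lip0 o Y) := {F | F.IsLipschitzCompact}

/-- `SA_K(M, Y) = SA(M, Y) ∩ Lip_K(M, Y)`. -/
def SAK : Set (Lip0 o Y) := SA o Y ∩ LipK o Y

/-- `SA_K(M, Y)` is norm dense in `Lip_K(M, Y)`. -/
def SAKDense : Prop := LipK o Y ⊆ closure (SAK o Y)

end PointedLip

end

/-! Composing `F` with a bounded operator `T` replaces the Lipschitz image of `F` by its image under
`T`. Norm, compactness and strong attainment of `T ∘ F` are therefore governed by how `T` acts on a
relatively compact set, and density can be moved between target spaces by suitable operators.

For `C(K, Y)` and `L_∞(μ, Y)`, choose a small place (a neighbourhood of a point, or a set of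
positive measure) where one slope of nearly maximal norm stays large and all members of the
Lipschitz image are nearly constant. Reading `F` there gives a `Y`-valued map. Approximate it by a
strongly attaining one, scale that up slightly so that it dominates the rest of `F`, and glue it
back (`SAKDense.of_localize`).

For `L_p(μ, Y)`, averaging over finitely many disjoint sets nearly fixes the Lipschitz image and
factors through an isometric copy of `ℓ_p^n(Y)` (`SAKDense.exists_norm_sub_le_of_factor`), so
density is needed for `ℓ_p^n(Y)`, an absolute summand of `ℓ_p(Y)`. If an `ℓ_p(Y)`-valued `G` close
to `F` attains its norm at a slope `z`, the coordinate projection `P` may destroy attainment. A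
functional norming `z` yields instead a contraction that folds the tail of `z` into the direction of
`P z`: it keeps the norm of `z` and acts on the summand as a scalar close to 1
(`SAKDense.of_absolute_summand`). -/

namespace PointedLip

variable {M : Type*} [MetricSpace M] {o : M}
variable {Y : Type*} [NormedAddCommGroup Y] [NormedSpace ℝ Y]
variable {Z : Type*} [NormedAddCommGroup Z] [NormedSpace ℝ Z]
variable {W : Type*} [NormedAddCommGroup W] [NormedSpace ℝ W]

/-! ### Lipschitz images and post-composition with operators -/

namespace Lip0

theorem norm_le_of_mem_lipschitzImage {F : Lip0 o Y} {y : Y} (hy : y ∈ lipschitzImage F) :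
    ‖y‖ ≤ ‖F‖ := by
  obtain ⟨p, q, hpq, rfl⟩ := hy
  rw [norm_smul, norm_inv, Real.norm_of_nonneg dist_nonneg, inv_mul_le_iff₀ (dist_pos.2 hpq),
    mul_comm]
  exact norm_sub_le_mul F p q

theorem norm_le_of_lipschitzImage {F : Lip0 o Y} {c : ℝ} (hc : 0 ≤ c)
    (h : ∀ y ∈ lipschitzImage F, ‖y‖ ≤ c) : ‖F‖ ≤ c := by
  refine norm_le_of F hc fun p q => ?_
  rcases eq_or_ne p q with rfl | hpq
  · simp
  · have := h _ ⟨p, q, hpq, rfl⟩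
    rwa [norm_smul, norm_inv, Real.norm_of_nonneg dist_nonneg, inv_mul_le_iff₀ (dist_pos.2 hpq),
      mul_comm] at this

theorem stronglyAttains_iff {F : Lip0 o Y} :
    F.StronglyAttains ↔ ∃ y ∈ lipschitzImage F, ‖F‖ ≤ ‖y‖ := by
  have key (p q : M) : ‖F p - F q‖ / dist p q = ‖(dist p q)⁻¹ • (F p - F q)‖ := by
    rw [norm_smul, norm_inv, Real.norm_of_nonneg dist_nonneg, div_eq_inv_mul]
  constructor
  · rintro ⟨p, q, hpq, h⟩
    exact ⟨_, ⟨p, q, hpq, rfl⟩, by rw [← key, h]⟩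
  · rintro ⟨_, ⟨p, q, hpq, rfl⟩, h⟩
    exact ⟨p, q, hpq, (key p q).trans
      (le_antisymm (norm_le_of_mem_lipschitzImage ⟨p, q, hpq, rfl⟩) h)⟩

theorem IsLipschitzCompact.of_subset {F : Lip0 o Y} {S : Set Y} (hS : IsCompact S)
    (h : lipschitzImage F ⊆ S) : F.IsLipschitzCompact :=
  hS.closure_of_subset h

/-- Post-composition of a Lipschitz map with a continuous linear map. -/
def map (T : Y →L[ℝ] Z) (F : Lip0 o Y) : Lip0 o Z :=
  ⟨fun p => T (F p), by
    obtain ⟨⟨C, hC⟩, h0⟩ := F.2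
    exact ⟨⟨_, T.lipschitz.comp hC⟩, by simp [show F.1 o = 0 from h0]⟩⟩

@[simp] theorem map_apply (T : Y →L[ℝ] Z) (F : Lip0 o Y) (p : M) : F.map T p = T (F p) := rfl

theorem lipschitzImage_map (T : Y →L[ℝ] Z) (F : Lip0 o Y) :
    lipschitzImage (F.map T) = T '' lipschitzImage F := by
  ext z
  constructor
  · rintro ⟨p, q, hpq, rfl⟩
    exact ⟨_, ⟨p, q, hpq, rfl⟩, by simp⟩
  · rintro ⟨_, ⟨p, q, hpq, rfl⟩, rfl⟩
    exact ⟨p, q, hpq, by simp⟩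

theorem IsLipschitzCompact.map {F : Lip0 o Y} (hF : F.IsLipschitzCompact) (T : Y →L[ℝ] Z) :
    (F.map T).IsLipschitzCompact := by
  refine .of_subset (hF.image T.continuous) ?_
  rw [lipschitzImage_map]
  exact Set.image_mono subset_closure

theorem IsLipschitzCompact.add {F G : Lip0 o Y} (hF : F.IsLipschitzCompact)
    (hG : G.IsLipschitzCompact) : (F + G).IsLipschitzCompact := by
  refine .of_subset ((hF.prod hG).image continuous_add) ?_
  rintro _ ⟨p, q, hpq, rfl⟩
  refine ⟨(_, _), ⟨subset_closure ⟨p, q, hpq, rfl⟩, subset_closure ⟨p, q, hpq, rfl⟩⟩, ?_⟩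
  simp only [coe_add, ← smul_add]
  congr 1
  abel

theorem norm_map_le {T : Y →L[ℝ] Z} {c : ℝ} (hc : 0 ≤ c) (hT : ∀ y, ‖T y‖ ≤ c * ‖y‖)
    (F : Lip0 o Y) : ‖F.map T‖ ≤ c * ‖F‖ := by
  refine norm_le_of_lipschitzImage (mul_nonneg hc (norm_nonneg _)) ?_
  rw [lipschitzImage_map]
  rintro _ ⟨y, hy, rfl⟩
  exact (hT y).trans (mul_le_mul_of_nonneg_left (norm_le_of_mem_lipschitzImage hy) hc)

theorem norm_map_of_isometry {T : Y →L[ℝ] Z} (hT : ∀ y, ‖T y‖ = ‖y‖) (F : Lip0 o Y) :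
    ‖F.map T‖ = ‖F‖ := by
  refine le_antisymm (by simpa using norm_map_le zero_le_one (by simp [hT]) F) ?_
  refine norm_le_of_lipschitzImage (norm_nonneg _) fun y hy => ?_
  rw [← hT]
  exact norm_le_of_mem_lipschitzImage (by rw [lipschitzImage_map]; exact ⟨y, hy, rfl⟩)

theorem lipschitzImage_nonempty [Nontrivial M] (F : Lip0 o Y) : (lipschitzImage F).Nonempty := by
  obtain ⟨p, q, hpq⟩ := exists_pair_ne M
  exact ⟨_, p, q, hpq, rfl⟩

theorem exists_mem_lipschitzImage_lt [Nontrivial M] (F : Lip0 o Y) {ε : ℝ} (hε : 0 < ε) :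
    ∃ y ∈ lipschitzImage F, ‖F‖ - ε < ‖y‖ := by
  by_contra! h
  obtain ⟨y, hy⟩ := F.lipschitzImage_nonempty
  have := norm_le_of_lipschitzImage ((norm_nonneg y).trans (h y hy)) h
  linarith

end Lip0

/-! ### Strongly attaining maps and reductions for density -/

open Lip0

theorem zero_mem_LipK : (0 : Lip0 o Y) ∈ LipK o Y := by
  refine .of_subset isCompact_singleton (S := {0}) ?_
  rintro _ ⟨p, q, -, rfl⟩
  simp

theorem zero_mem_SAK [Nontrivial M] : (0 : Lip0 o Y) ∈ SAK o Y := by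
  obtain ⟨y, hy⟩ := (0 : Lip0 o Y).lipschitzImage_nonempty
  exact ⟨stronglyAttains_iff.2 ⟨y, hy, by simp⟩, zero_mem_LipK⟩

/-- Attainment demands two distinct points, so over a one-point space `SAK` is empty, whereas `LipK`
always contains 0. -/
theorem SAKDense.nontrivial (h : SAKDense o Y) : Nontrivial M := by
  obtain ⟨F, ⟨p, q, hpq, -⟩, -⟩ := closure_nonempty_iff.1 ⟨_, h (zero_mem_LipK (o := o))⟩
  exact ⟨p, q, hpq⟩

theorem SAKDense.exists_norm_sub_lt (h : SAKDense o Y) {F : Lip0 o Y} (hF : F ∈ LipK o Y)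
    {ε : ℝ} (hε : 0 < ε) : ∃ G ∈ SAK o Y, ‖F - G‖ < ε := by
  simpa [dist_eq_norm] using Metric.mem_closure_iff.1 (h hF) ε hε

/-- To prove density it suffices to approximate nonzero maps up to a fixed multiple of arbitrarily
small errors. -/
theorem SAKDense.of_approx [Nontrivial M] (c : ℝ)
    (h : ∀ F ∈ LipK o Y, ∀ ε > 0, 6 * ε < ‖F‖ → ∃ G ∈ SAK o Y, ‖F - G‖ ≤ c * ε) :
    SAKDense o Y := by
  intro F hF
  rcases eq_or_ne F 0 with rfl | hF0
  · exact subset_closure zero_mem_SAK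
  refine Metric.mem_closure_iff.2 fun ε hε => ?_
  have hF1 : 0 < ‖F‖ := norm_pos_iff.2 hF0
  -- The seventh gives the strict inequality `6 * ε < ‖F‖`; dividing by `|c| + 1` makes the final
  -- error strictly smaller than `ε` whatever the sign of `c`.
  obtain ⟨G, hG, hFG⟩ := h F hF (min (‖F‖ / 7) (ε / (|c| + 1))) (by positivity) (by
    linarith [min_le_left (‖F‖ / 7) (ε / (|c| + 1))])
  refine ⟨G, hG, ?_⟩
  rw [dist_eq_norm]
  have h1 : min (‖F‖ / 7) (ε / (|c| + 1)) * (|c| + 1) ≤ ε :=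
    (le_div_iff₀ (by positivity)).1 (min_le_right _ _)
  have h0 : 0 < min (‖F‖ / 7) (ε / (|c| + 1)) := by positivity
  nlinarith [le_abs_self c]

theorem mem_SAK_map_of_isometry {T : Y →L[ℝ] Z} (hT : ∀ y, ‖T y‖ = ‖y‖) {F : Lip0 o Y}
    (hF : F ∈ SAK o Y) : F.map T ∈ SAK o Z := by
  refine ⟨?_, hF.2.map T⟩
  obtain ⟨y, hy, h⟩ := stronglyAttains_iff.1 hF.1
  refine stronglyAttains_iff.2 ⟨T y, ?_, ?_⟩
  · rw [lipschitzImage_map]; exact ⟨y, hy, rfl⟩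
  · rwa [norm_map_of_isometry hT, hT]

theorem smul_mem_SAK {F : Lip0 o Y} (hF : F ∈ SAK o Y) (t : ℝ) : t • F ∈ SAK o Y := by
  have e : t • F = F.map (t • ContinuousLinearMap.id ℝ Y) := rfl
  refine ⟨?_, e ▸ hF.2.map _⟩
  obtain ⟨y, hy, h⟩ := stronglyAttains_iff.1 hF.1
  refine stronglyAttains_iff.2 ⟨t • y, ?_, ?_⟩
  · rw [e, lipschitzImage_map]; exact ⟨y, hy, rfl⟩
  · rw [norm_smul, norm_smul]; gcongr

/-! ### Transfer by factorization and by localization -/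

/-- A Lipschitz compact map is approximable by maps in `SAK` as soon as its Lipschitz image is
almost fixed by an operator factoring through a space `W` which embeds isometrically and for which
`SAK` is dense. -/
theorem SAKDense.exists_norm_sub_le_of_factor (hW : SAKDense o W) {F : Lip0 o Z}
    (hF : F ∈ LipK o Z) {ε : ℝ} (hε : 0 < ε) (i : W →L[ℝ] Z) (hi : ∀ w, ‖i w‖ = ‖w‖)
    (Q : Z →L[ℝ] W) (h : ∀ z ∈ lipschitzImage F, ‖i (Q z) - z‖ ≤ ε) :
    ∃ G ∈ SAK o Z, ‖F - G‖ ≤ 2 * ε := by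
  obtain ⟨G, hG, hFG⟩ := hW.exists_norm_sub_lt (hF.map Q) hε
  refine ⟨G.map i, mem_SAK_map_of_isometry hi hG, ?_⟩
  have e1 : F - G.map i = F.map (.id ℝ Z - i ∘L Q) + (F.map Q - G).map i :=
    ext_coe fun p => by simp
  rw [e1, two_mul]
  refine (norm_add_le _ _).trans (add_le_add ?_ ?_)
  · refine norm_le_of_lipschitzImage hε.le ?_
    rw [lipschitzImage_map]
    rintro _ ⟨z, hz, rfl⟩
    rw [← norm_neg]
    simpa using h z hz
  · rw [norm_map_of_isometry hi]
    exact hFG.le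

/-- Perturbing a Lipschitz map along one coordinate carrying almost all of its norm. -/
theorem SAKDense.of_localize (hY : SAKDense o Y)
    (h : ∀ S : Set Z, IsCompact S → ∀ z ∈ S, ∀ ε > 0,
      ∃ (R : Z →L[ℝ] Z) (j : Y →L[ℝ] Z) (Q : Z →L[ℝ] Y),
        (∀ z y, ‖R z + j y‖ ≤ max ‖z‖ ‖y‖) ∧ (∀ z y, ‖y‖ ≤ ‖R z + j y‖) ∧
        (∀ z ∈ S, ‖R z + j (Q z) - z‖ ≤ ε) ∧ ‖z‖ - ε ≤ ‖Q z‖) :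
    SAKDense o Z := by
  have := hY.nontrivial
  refine .of_approx 5 fun F hF ε hε hFε => ?_
  obtain ⟨z, hz, hzF⟩ := F.exists_mem_lipschitzImage_lt hε
  obtain ⟨R, j, Q, h1, h2, h3, h4⟩ := h _ hF z (subset_closure hz) ε hε
  have hQF : ‖F‖ - 2 * ε ≤ ‖F.map Q‖ := by
    have := norm_le_of_mem_lipschitzImage (F := F.map Q) (y := Q z)
      (by rw [lipschitzImage_map]; exact ⟨z, hz, rfl⟩)
    linarith
  obtain ⟨G₁, hG₁, hG₁F⟩ := hY.exists_norm_sub_lt (hF.map Q) hε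
  have hn : ‖F‖ - 3 * ε ≤ ‖G₁‖ := by
    linarith [norm_sub_norm_le (F.map Q) G₁]
  have hpos : 0 < ‖G₁‖ := by linarith
  -- The scaling adds exactly `3 * ε` to the norm, which lifts `‖G₀‖` to at least `‖F‖`. The maximum
  -- in `h1` is then controlled by the `Y`-part alone.
  set t : ℝ := 1 + 3 * ε / ‖G₁‖ with ht
  have ht0 : 0 < t := by positivity
  have hG₀ : ‖t • G₁‖ = ‖G₁‖ + 3 * ε := by
    rw [norm_smul, Real.norm_of_nonneg ht0.le, ht]
    field_simp
  have hd : ‖t • G₁ - G₁‖ = 3 * ε := by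
    have : t • G₁ - G₁ = (3 * ε / ‖G₁‖) • G₁ := by rw [ht, add_smul, one_smul]; abel
    rw [this, norm_smul, Real.norm_of_nonneg (by positivity)]
    field_simp
  set G₀ := t • G₁
  have hG₀S : G₀ ∈ SAK o Y := smul_mem_SAK hG₁ t
  have himg : ∀ p q : M, (dist p q)⁻¹ • ((F.map R + G₀.map j) p - (F.map R + G₀.map j) q) =
      R ((dist p q)⁻¹ • (F p - F q)) + j ((dist p q)⁻¹ • (G₀ p - G₀ q)) := fun p q => by
    simp only [coe_add, map_apply, _root_.map_smul, _root_.map_sub, ← smul_add]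
    congr 1
    abel
  have hle : ‖F.map R + G₀.map j‖ ≤ ‖G₀‖ := by
    refine norm_le_of_lipschitzImage (norm_nonneg _) ?_
    rintro _ ⟨p, q, hpq, rfl⟩
    rw [himg]
    refine (h1 _ _).trans (max_le ?_ (norm_le_of_mem_lipschitzImage ⟨p, q, hpq, rfl⟩))
    refine (norm_le_of_mem_lipschitzImage ⟨p, q, hpq, rfl⟩).trans ?_
    linarith
  refine ⟨F.map R + G₀.map j, ⟨?_, (hF.map R).add (hG₀S.2.map j)⟩, ?_⟩
  -- A pair at which `G₀` attains also works for the glued map: `h2` bounds its slope there from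
  -- below by that of `G₀`.
  · obtain ⟨_, ⟨p, q, hpq, rfl⟩, hy⟩ := stronglyAttains_iff.1 hG₀S.1
    refine stronglyAttains_iff.2 ⟨_, ⟨p, q, hpq, rfl⟩, ?_⟩
    rw [himg]
    exact hle.trans (hy.trans (h2 _ _))
  -- The error is `ε` from gluing, `ε` from approximating `Q ∘ F` by `G₁`, and `3 * ε` from the
  -- scaling.
  · have e1 : F - (F.map R + G₀.map j) =
        F.map (.id ℝ Z - R - j ∘L Q) + (F.map Q - G₀).map j := ext_coe fun p => by
      simp; abel
    have hb1 : ‖F.map (.id ℝ Z - R - j ∘L Q)‖ ≤ ε := by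
      refine norm_le_of_lipschitzImage hε.le ?_
      rw [lipschitzImage_map]
      rintro _ ⟨w, hw, rfl⟩
      have e : (ContinuousLinearMap.id ℝ Z - R - j ∘L Q) w = -(R w + j (Q w) - w) := by
        simp; abel
      rw [e, norm_neg]
      exact h3 w (subset_closure hw)
    have hb2 : ‖(F.map Q - G₀).map j‖ ≤ 1 * ‖F.map Q - G₀‖ :=
      norm_map_le zero_le_one (fun y => by simpa using h1 0 y) _
    have hb3 : ‖F.map Q - G₀‖ ≤ ‖F.map Q - G₁‖ + ‖G₀ - G₁‖ := by
      rw [norm_sub_rev G₀]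
      exact norm_sub_le_norm_sub_add_norm_sub ..
    rw [e1]
    linarith [norm_add_le (F.map (.id ℝ Z - R - j ∘L Q)) ((F.map Q - G₀).map j)]

/-! ### Absolute summands -/

/-- A one-sided bound on a ball suffices because the ball is symmetric: rescale `w` to norm `r` and
use both signs. -/
theorem dual_norm_mul_le {f : W →L[ℝ] ℝ} {r c : ℝ} (hr : 0 ≤ r) (hc : 0 ≤ c)
    (h : ∀ w, ‖w‖ ≤ r → f w ≤ c) : ‖f‖ * r ≤ c := by
  rcases hr.eq_or_lt with rfl | hr
  · simpa using hc
  rw [← le_div_iff₀ hr]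
  refine f.opNorm_le_bound (by positivity) fun w => ?_
  rcases eq_or_ne w 0 with rfl | hw
  · simp
  have hw' : 0 < ‖w‖ := norm_pos_iff.2 hw
  have key : ∀ s : ℝ, |s| = 1 → s * f w ≤ c / r * ‖w‖ := fun s hs => by
    have := h ((s * (r / ‖w‖)) • w) (by
      rw [norm_smul, norm_mul, Real.norm_eq_abs, hs, Real.norm_of_nonneg (by positivity)]
      field_simp; rfl)
    rw [map_smul, smul_eq_mul] at this
    rw [div_mul_eq_mul_div, le_div_iff₀ hr]
    calc s * f w * r = (s * (r / ‖w‖) * f w) * ‖w‖ := by field_simp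
      _ ≤ c * ‖w‖ := by gcongr
  rw [Real.norm_eq_abs]
  exact abs_le'.2 ⟨by simpa using key 1 (by simp), by simpa using key (-1) (by simp)⟩

/-- Given `z` in the absolute sum of `W` and `ker P`, there is a contraction onto `W` that attains
its norm at `z` and is a multiple of the identity on `W`. -/
theorem exists_contraction_attaining (i : W →L[ℝ] Z) (hi : ∀ w, ‖i w‖ = ‖w‖)
    (P : Z →L[ℝ] W) (hPi : ∀ w, P (i w) = w)
    (h : ∀ u u' v, ‖u'‖ ≤ ‖u‖ → P v = 0 → ‖i u' + v‖ ≤ ‖i u + v‖)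
    (z : Z) (hz : P z ≠ 0) :
    ∃ (a : ℝ) (T : Z →L[ℝ] W), a ≤ 1 ∧ ‖z‖ - ‖z - i (P z)‖ ≤ a * ‖P z‖ ∧
      (∀ x, ‖T x‖ ≤ ‖x‖) ∧ ‖z‖ ≤ ‖T z‖ ∧ ∀ w, T (i w) = a • w := by
  obtain ⟨g, hg1, hgz⟩ := exists_dual_vector'' ℝ z
  have hg (x : Z) : g x ≤ ‖x‖ :=
    (le_abs_self _).trans ((g.le_opNorm x).trans (mul_le_of_le_one_left (norm_nonneg _) hg1))
  have hgz' : g z = ‖z‖ := hgz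
  set a := ‖g ∘L i‖
  have ha1 : a ≤ 1 := ContinuousLinearMap.opNorm_le_bound _ zero_le_one fun w => by
    rw [← hi w]
    exact (g.le_opNorm (i w)).trans (mul_le_mul_of_nonneg_right hg1 (norm_nonneg _))
  have hPz : 0 < ‖P z‖ := norm_pos_iff.2 hz
  have hker (x : Z) : P (x - i (P x)) = 0 := by rw [map_sub, hPi, sub_self]
  have hga : g (i (P z)) ≤ a * ‖P z‖ :=
    (le_abs_self _).trans ((g ∘L i).le_opNorm (P z))
  have hsplit : g (i (P z)) + g (z - i (P z)) = ‖z‖ := by rw [map_sub, hgz']; ring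
  let e : W := ‖P z‖⁻¹ • P z
  have he : ‖e‖ = 1 := by
    rw [norm_smul, norm_inv, norm_norm, inv_mul_cancel₀ hPz.ne']
  let v : Z →L[ℝ] Z := .id ℝ Z - i ∘L P
  have hv (x : Z) : v x = x - i (P x) := by simp [v]
  -- The complementary part `v x` is compressed to the number `g (v x)` and placed along the
  -- direction `e` of `P z`. At `z` both terms point along `e`, so their lengths add up to at least
  -- `g z = ‖z‖`.
  let T : Z →L[ℝ] W := a • P + (g ∘L v).smulRight e
  have hT (x : Z) : T x = a • P x + g (x - i (P x)) • e := by simp [T, hv]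
  refine ⟨a, T, ha1, ?_, fun x => ?_, ?_, fun w => ?_⟩
  · have := hg (z - i (P z))
    linarith
  -- Contractivity is `a * ‖P x‖ + |g (v x)| ≤ ‖x‖`. Absoluteness lets `P x` be replaced by any `w`
  -- of no larger norm without increasing `‖x‖`; taking the supremum of `g (i w)` produces `a * ‖P
  -- x‖`. The sign `s = -1` uses `-w` and a global reflection.
  · have key : ∀ s : ℝ, |s| = 1 → a * ‖P x‖ ≤ ‖x‖ - s * g (x - i (P x)) := fun s hs => by
      have hbd : ∀ w, ‖w‖ ≤ ‖P x‖ → g (i w) + s * g (x - i (P x)) ≤ ‖x‖ := fun w hw => by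
        have h1 := h (P x) w (x - i (P x)) hw (hker x)
        have h2 := h (P x) (-w) (x - i (P x)) (by rwa [norm_neg]) (hker x)
        rw [add_sub_cancel] at h1 h2
        rcases eq_or_eq_neg_of_abs_eq hs with rfl | rfl
        · have := hg (i w + (x - i (P x)))
          rw [map_add] at this
          linarith
        · have := hg (-(i (-w) + (x - i (P x))))
          rw [norm_neg, map_neg g, map_add, map_neg i, map_neg g] at this
          rw [map_neg i] at h2
          linarith
      refine dual_norm_mul_le (norm_nonneg _) ?_ fun w hw => ?_
      · simpa using hbd 0 (by simp)
      · have := hbd w hw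
        rw [ContinuousLinearMap.comp_apply]
        linarith
    have hb : ‖T x‖ ≤ a * ‖P x‖ + |g (x - i (P x))| := by
      rw [hT]
      refine (norm_add_le _ _).trans (add_le_add ?_ ?_)
      · rw [norm_smul, norm_norm]
      · rw [norm_smul, he, mul_one, Real.norm_eq_abs]
    have h1 := key 1 (by simp)
    have h2 := key (-1) (by simp)
    rcases abs_cases (g (x - i (P x))) with ⟨h3, -⟩ | ⟨h3, -⟩ <;> linarith
  · have : T z = (a * ‖P z‖ + g (z - i (P z))) • e := by
      rw [hT, add_smul, mul_smul]
      congr 2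
      rw [smul_smul, mul_inv_cancel₀ hPz.ne', one_smul]
    rw [this, norm_smul, he, mul_one]
    exact le_trans (by linarith) (le_abs_self _)
  · simp [hT, hPi]

/-- Density of `SAK` passes to absolute summands of the target space. -/
theorem SAKDense.of_absolute_summand (hZ : SAKDense o Z) (i : W →L[ℝ] Z) (hi : ∀ w, ‖i w‖ = ‖w‖)
    (P : Z →L[ℝ] W) (hPi : ∀ w, P (i w) = w)
    (h : ∀ u u' v, ‖u'‖ ≤ ‖u‖ → P v = 0 → ‖i u' + v‖ ≤ ‖i u + v‖) : SAKDense o W := by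
  have := hZ.nontrivial
  refine .of_approx 4 fun F hF ε hε hFε => ?_
  obtain ⟨G, hG, hFG⟩ := hZ.exists_norm_sub_lt (hF.map i) hε
  obtain ⟨z, hz, hGz⟩ := stronglyAttains_iff.1 hG.1
  have hzG := norm_le_of_mem_lipschitzImage hz
  have hker (x : Z) : P (x - i (P x)) = 0 := by rw [map_sub, hPi, sub_self]
  -- Flipping the sign of the `W`-part does not increase the norm, and `x` minus its flip is `2 • i
  -- (P x)`.
  have hP (x : Z) : ‖P x‖ ≤ ‖x‖ := by
    have h1 := h (P x) (-P x) (x - i (P x)) (by rw [norm_neg]) (hker x)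
    rw [add_sub_cancel] at h1
    have h2 := norm_sub_le x (i (-P x) + (x - i (P x)))
    have e : x - (i (-P x) + (x - i (P x))) = i ((2 : ℝ) • P x) := by
      rw [map_neg, map_smul, two_smul]; abel
    rw [e, hi, norm_smul, Real.norm_of_nonneg zero_le_two] at h2
    linarith
  have hv : ‖z - i (P z)‖ ≤ 2 * ε := by
    let v : Z →L[ℝ] Z := .id ℝ Z - i ∘L P
    -- The complementary projection kills `i ∘ F`, so on `G` it sees only the approximation error.
    have e : G.map v = (G - F.map i).map v := ext_coe fun p => by simp [v, hPi]
    have h1 : ‖(G - F.map i).map v‖ ≤ 2 * ‖G - F.map i‖ :=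
      norm_map_le zero_le_two (fun x => by
        have h1 := norm_sub_le x (i (P x))
        rw [hi] at h1
        have h2 : v x = x - i (P x) := by simp [v]
        rw [h2]
        linarith [hP x]) _
    rw [← e, norm_sub_rev] at h1
    have h2 : ‖v z‖ ≤ ‖G.map v‖ :=
      norm_le_of_mem_lipschitzImage (by rw [lipschitzImage_map]; exact ⟨z, hz, rfl⟩)
    have h3 : v z = z - i (P z) := by simp [v]
    rw [h3] at h2
    linarith
  have hFG' : |‖F‖ - ‖G‖| ≤ ε := by
    rw [← norm_map_of_isometry hi F]
    exact (abs_norm_sub_norm_le _ _).trans hFG.le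
  rw [abs_le] at hFG'
  have hPz : P z ≠ 0 := by
    intro h0
    rw [h0, map_zero, sub_zero] at hv
    linarith
  obtain ⟨a, T, ha1, ha, hT, hTz, hTi⟩ := exists_contraction_attaining i hi P hPi h z hPz
  have hTG : ‖G.map T‖ ≤ ‖G‖ := by
    simpa using norm_map_le zero_le_one (fun x => by simpa using hT x) G
  refine ⟨G.map T, ⟨stronglyAttains_iff.2 ⟨T z, ?_, by linarith⟩, hG.2.map T⟩, ?_⟩
  · rw [lipschitzImage_map]; exact ⟨z, hz, rfl⟩
  · have e : F - G.map T = (1 - a) • F + (F.map i - G).map T := ext_coe fun p => by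
      simp [hTi, sub_smul]
    have h1 : ‖(F.map i - G).map T‖ ≤ 1 * ‖F.map i - G‖ :=
      norm_map_le zero_le_one (fun x => by simpa using hT x) _
    have h2 : ‖(1 - a) • F‖ = (1 - a) * ‖F‖ := by
      rw [norm_smul, Real.norm_of_nonneg (by linarith)]
    -- Since `‖P z‖ ≤ ‖z‖`, this makes `(1 - a) * ‖P z‖` at most `2 * ε`. As `‖F‖` exceeds `‖P z‖`
    -- by at most `3 * ε`, the term `(1 - a) • F` is small.
    have h3 : (1 - a) * ‖P z‖ ≤ ‖P z‖ - ‖z‖ + 2 * ε := by linarith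
    have ha0 : 0 ≤ a := by
      by_contra! h0
      have := mul_nonpos_of_nonpos_of_nonneg h0.le (norm_nonneg (P z))
      linarith
    have hPG : ‖z‖ - 2 * ε ≤ ‖P z‖ := by
      have := mul_le_of_le_one_left (norm_nonneg (P z)) ha1
      linarith
    have h4 : (1 - a) * ‖F‖ ≤ (1 - a) * ‖P z‖ + (1 - a) * (3 * ε) := by
      rw [← mul_add]
      exact mul_le_mul_of_nonneg_left (by linarith) (by linarith)
    have h5 := hP z
    rw [e]
    have h6 := norm_add_le ((1 - a) • F) ((F.map i - G).map T)
    nlinarith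

/-! ### Continuous functions on a compact space -/

theorem SAKDense.of_subsingleton [Nontrivial M] [Subsingleton Z] : SAKDense o Z := by
  intro F _
  rw [show F = 0 from ext_coe fun p => Subsingleton.elim _ _]
  exact subset_closure zero_mem_SAK

theorem norm_one_sub_smul_add_smul_le {t : ℝ} (ht : t ∈ Set.Icc (0 : ℝ) 1) (x y : Y) :
    ‖(1 - t) • x + t • y‖ ≤ max ‖x‖ ‖y‖ := by
  refine (norm_add_le _ _).trans ?_
  rw [norm_smul, norm_smul, Real.norm_of_nonneg (sub_nonneg.2 ht.2), Real.norm_of_nonneg ht.1]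
  nlinarith [ht.1, ht.2, le_max_left ‖x‖ ‖y‖, le_max_right ‖x‖ ‖y‖]

/-- Density of `SAK` passes from `Y` to `C(K, Y)`. -/
theorem SAKDense.continuousMap (hY : SAKDense o Y) (K : Type*) [TopologicalSpace K]
    [CompactSpace K] [T2Space K] : SAKDense o C(K, Y) := by
  have := hY.nontrivial
  rcases isEmpty_or_nonempty K with hK | hK
  · exact .of_subsingleton
  refine hY.of_localize fun S hS z hz ε hε => ?_
  obtain ⟨t₀, ht₀⟩ : ∃ t₀, ‖z‖ - ε ≤ ‖z t₀‖ := by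
    by_contra! h
    have := (ContinuousMap.norm_lt_iff_of_nonempty z).2 h
    linarith
  -- Compactness of `S` gives equicontinuity at `t₀`, hence one neighbourhood for all of `S`. The
  -- Urysohn function `φ` supported there then glues by the convex combination `(1 - φ) • f + φ •
  -- y`.
  have hev : ∀ᶠ t in nhds t₀, ∀ f ∈ S, ‖f t₀ - f t‖ < ε := by
    refine hS.eventually_forall_of_forall_eventually fun f _ => ?_
    have hc : Continuous fun x : K × C(K, Y) => ‖x.2 t₀ - x.2 x.1‖ := by fun_prop
    exact hc.continuousAt.eventually_lt continuousAt_const (by simpa using hε)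
  obtain ⟨U, hUS, hU, htU⟩ := eventually_nhds_iff.1 hev
  obtain ⟨φ, hφ0, hφ1, hφ⟩ := exists_continuous_zero_one_of_isClosed hU.isClosed_compl
    (isClosed_singleton (x := t₀)) (by simpa using htU)
  have hφ1 : φ t₀ = 1 := hφ1 rfl
  let R : C(K, Y) →L[ℝ] C(K, Y) := LinearMap.mkContinuous
    { toFun := fun f => ⟨fun t => (1 - φ t) • f t, by fun_prop⟩
      map_add' := fun f g => by ext t; simp
      map_smul' := fun c f => by ext t; simp [smul_comm c] } 1 fun f => by
    rw [one_mul, ContinuousMap.norm_le _ (norm_nonneg _)]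
    intro t
    have := norm_one_sub_smul_add_smul_le (hφ t) (f t) 0
    rw [norm_zero, max_eq_left (norm_nonneg _), smul_zero, add_zero] at this
    exact this.trans (f.norm_coe_le_norm t)
  let j : Y →L[ℝ] C(K, Y) := LinearMap.mkContinuous
    { toFun := fun y => ⟨fun t => φ t • y, by fun_prop⟩
      map_add' := fun f g => by ext t; simp
      map_smul' := fun c f => by ext t; simp [smul_comm c] } 1 fun y => by
    rw [one_mul, ContinuousMap.norm_le _ (norm_nonneg _)]
    intro t
    have := norm_one_sub_smul_add_smul_le (hφ t) 0 y
    rwa [norm_zero, max_eq_right (norm_nonneg _), smul_zero, zero_add] at this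
  have hRj (f : C(K, Y)) (y : Y) (t : K) : (R f + j y) t = (1 - φ t) • f t + φ t • y := rfl
  refine ⟨R, j, ContinuousMap.evalCLM ℝ t₀, fun f y => ?_, fun f y => ?_, fun f hf => ?_, ht₀⟩
  · refine (ContinuousMap.norm_le _ (by positivity)).2 fun t => ?_
    rw [hRj]
    exact (norm_one_sub_smul_add_smul_le (hφ t) _ _).trans
      (max_le_max_right _ (f.norm_coe_le_norm t))
  · have h := (R f + j y).norm_coe_le_norm t₀
    rwa [hRj, hφ1, sub_self, zero_smul, one_smul, zero_add] at h
  · refine (ContinuousMap.norm_le _ hε.le).2 fun t => ?_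
    have e : (R f + j (ContinuousMap.evalCLM ℝ t₀ f) - f) t = φ t • (f t₀ - f t) := by
      rw [ContinuousMap.sub_apply, hRj, sub_smul, one_smul, smul_sub]
      simp only [ContinuousMap.evalCLM_apply]
      abel
    rw [e, norm_smul, Real.norm_of_nonneg (hφ t).1]
    by_cases ht : t ∈ U
    · exact (mul_le_of_le_one_left (norm_nonneg _) (hφ t).2).trans (hUS t ht f hf).le
    · rw [hφ0 ht]
      simpa using hε.le

/-! ### Finite `ℓ_p`-sums -/

/-- Density of `SAK` passes from `ℓ_p(Y)` to `ℓ_p^n(Y)`. -/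
theorem SAKDense.piLp {p : ℝ≥0∞} [Fact (1 ≤ p)] (hp : p ≠ ∞)
    (h : SAKDense o (lp (fun _ : ℕ => Y) p)) (n : ℕ) :
    SAKDense o (PiLp p (fun _ : Fin n => Y)) := by
  have hp0 : 0 < p.toReal :=
    ENNReal.toReal_pos (zero_lt_one.trans_le (Fact.out : 1 ≤ p)).ne' hp
  let E : ℕ → Type _ := fun _ => Y
  let i : PiLp p (fun _ : Fin n => Y) →L[ℝ] lp E p :=
    ∑ k : Fin n, lp.singleContinuousLinearMap ℝ E p k ∘L PiLp.proj p (fun _ : Fin n => Y) k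
  let P : lp E p →L[ℝ] PiLp p (fun _ : Fin n => Y) :=
    (PiLp.continuousLinearEquiv p ℝ (fun _ : Fin n => Y)).symm.toContinuousLinearMap ∘L
      ContinuousLinearMap.pi fun k : Fin n => lp.evalCLM ℝ E p (k : ℕ)
  have hP (x : lp E p) (k : Fin n) : P x k = x k := rfl
  have hi (u : PiLp p (fun _ : Fin n => Y)) : i u = ∑ k : Fin n, lp.single p (k : ℕ) (u k) := by
    simp [i]
  have hPi (u : PiLp p (fun _ : Fin n => Y)) : P (i u) = u := by
    ext k
    rw [hP, hi, lp.coeFn_sum, Finset.sum_apply, Finset.sum_eq_single k]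
    · exact lp.single_apply_self p _ _
    · exact fun l _ hl => lp.single_apply_ne p _ _ fun h => hl (Fin.ext h.symm)
    · simp
  have hiP (x : lp E p) : ∑ k ∈ Finset.range n, lp.single p k (x k) = i (P x) := by
    rw [hi, Finset.sum_range]
    rfl
  have hnorm (u : PiLp p (fun _ : Fin n => Y)) : ‖i u‖ = ‖u‖ := by
    have h1 := lp.norm_sum_single hp0 (fun k => i u k) (Finset.range n)
    rw [hiP (i u), hPi, Finset.sum_range] at h1
    rw [PiLp.norm_eq_sum hp0, ← Real.rpow_left_inj (norm_nonneg _) (by positivity) hp0.ne', h1,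
      ← Real.rpow_mul (by positivity), one_div, inv_mul_cancel₀ hp0.ne', Real.rpow_one]
    refine Finset.sum_congr rfl fun k _ => ?_
    rw [← hP, hPi]
  -- The first `n` coordinates and the tail have additive `p`-th powers of norms; the resulting norm
  -- is monotone in `‖u‖`, which is absoluteness.
  have hsplit (u : PiLp p (fun _ : Fin n => Y)) (v : lp E p) (hv : P v = 0) :
      ‖i u + v‖ ^ p.toReal = ‖u‖ ^ p.toReal + ‖v‖ ^ p.toReal := by
    have h1 := lp.norm_sub_norm_compl_sub_single hp0 (i u + v) (Finset.range n)
    rw [← lp.norm_sum_single hp0, hiP, map_add, hPi, hv, add_zero, add_sub_cancel_left, hnorm] at h1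
    linarith
  refine h.of_absolute_summand i hnorm P hPi fun u u' v huu hv => ?_
  rw [← Real.rpow_le_rpow_iff (norm_nonneg _) (norm_nonneg _) hp0, hsplit _ _ hv, hsplit _ _ hv]
  gcongr

/-- By disjointness at most one summand is nonzero at each point, so `g` need not be additive. -/
theorem map_sum_indicator {Ω ι E F : Type*} [Fintype ι] [AddCommMonoid E] [AddCommMonoid F]
    {A : ι → Set Ω} (hd : Pairwise fun k l => Disjoint (A k) (A l)) (c : ι → E) (g : E → F)
    (hg : g 0 = 0) (x : Ω) :
    g (∑ k, (A k).indicator (fun _ => c k) x) = ∑ k, (A k).indicator (fun _ => g (c k)) x := by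
  by_cases h : ∃ k, x ∈ A k
  · obtain ⟨k, hk⟩ := h
    have hl (l : ι) (hlk : l ≠ k) : x ∉ A l := fun hx => (hd hlk).notMem_of_mem_left hx hk
    rw [Finset.sum_eq_single k (fun l _ h => by simp [hl l h]) (by simp),
      Finset.sum_eq_single k (fun l _ h => by simp [hl l h]) (by simp),
      Set.indicator_of_mem hk, Set.indicator_of_mem hk]
  · push Not at h
    simp [h, hg]

/-! ### Lebesgue–Bochner spaces: near-constancy, step functions, averages -/

section Lp

variable {Y : Type*} [NormedAddCommGroup Y]
variable {Ω : Type*} [MeasurableSpace Ω] {μ : Measure Ω} {p : ℝ≥0∞}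

theorem ae_norm_le_norm_top (f : Lp Y ∞ μ) : ∀ᵐ x ∂μ, ‖f x‖ ≤ ‖f‖ := by
  filter_upwards [ae_le_eLpNormEssSup (f := f) (μ := μ)] with x hx
  rw [Lp.norm_def, eLpNorm_exponent_top, ← toReal_enorm]
  refine ENNReal.toReal_mono ?_ hx
  rw [← eLpNorm_exponent_top]
  exact Lp.eLpNorm_ne_top f

theorem norm_top_le_of_ae_bound {f : Lp Y ∞ μ} {c : ℝ} (hc : 0 ≤ c)
    (h : ∀ᵐ x ∂μ, ‖f x‖ ≤ c) : ‖f‖ ≤ c := by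
  rw [Lp.norm_def, eLpNorm_exponent_top]
  exact ENNReal.toReal_le_of_le_ofReal hc (eLpNormEssSup_le_of_ae_bound h)

/-- The range is separable, so countably many `δ`-balls cover it; were all the preimages null within
`B`, so would be `B`. -/
theorem exists_subset_near_const {f : Ω → Y} (hf : StronglyMeasurable f) {B : Set Ω}
    (hB : MeasurableSet B) (hB0 : μ B ≠ 0) {δ : ℝ} (hδ : 0 < δ) :
    ∃ A ⊆ B, MeasurableSet A ∧ μ A ≠ 0 ∧ ∃ c, ∀ x ∈ A, ‖f x - c‖ ≤ δ := by
  obtain ⟨t, ht, hft⟩ := hf.isSeparable_range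
  have hmeas (c : Y) : MeasurableSet (B ∩ {x | ‖f x - c‖ ≤ δ}) :=
    hB.inter (measurableSet_le (hf.sub stronglyMeasurable_const).norm.measurable measurable_const)
  by_contra! h
  refine hB0 (measure_mono_null (t := ⋃ c ∈ t, B ∩ {x | ‖f x - c‖ ≤ δ}) ?_
    ((measure_biUnion_null_iff ht).2 fun c _ => ?_))
  · intro x hx
    obtain ⟨c, hc, hxc⟩ := Metric.mem_closure_iff.1 (hft ⟨x, rfl⟩) δ hδ
    rw [dist_eq_norm] at hxc
    exact Set.mem_biUnion hc ⟨hx, hxc.le⟩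
  · by_contra h0
    obtain ⟨x, hx, hlt⟩ := h _ Set.inter_subset_left (hmeas c) h0 c
    exact hlt.not_ge hx.2

/-- Treat the functions one at a time, shrinking the set; bounds already obtained persist on
subsets. -/
theorem exists_subset_forall_near_const {s : Set (Lp Y p μ)} (hs : s.Finite) {B : Set Ω}
    (hB : MeasurableSet B) (hB0 : μ B ≠ 0) {δ : ℝ} (hδ : 0 < δ) :
    ∃ A ⊆ B, MeasurableSet A ∧ μ A ≠ 0 ∧ ∀ f ∈ s, ∃ c, ∀ x ∈ A, ‖f x - c‖ ≤ δ := by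
  induction s, hs using Set.Finite.induction_on with
  | empty => exact ⟨B, subset_rfl, hB, hB0, by simp⟩
  | @insert f s _ _ ih =>
    obtain ⟨A, hAB, hA, hA0, h⟩ := ih
    obtain ⟨A', hAA', hA', hA0', c, hc⟩ :=
      exists_subset_near_const (Lp.stronglyMeasurable f) hA hA0 hδ
    refine ⟨A', hAA'.trans hAB, hA', hA0', fun g hg => ?_⟩
    rcases hg with rfl | hg
    · exact ⟨c, hc⟩
    · obtain ⟨d, hd⟩ := h g hg
      exact ⟨d, fun x hx => hd x (hAA' hx)⟩

theorem lp_norm_rpow_eq_integral [Fact (1 ≤ p)] (hp : p ≠ ∞) (f : Lp Y p μ) :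
    ‖f‖ ^ p.toReal = ∫ x, ‖f x‖ ^ p.toReal ∂μ := by
  have hp1 : p ≠ 0 := (zero_lt_one.trans_le (Fact.out : 1 ≤ p)).ne'
  have h0 : 0 ≤ ∫ x, ‖f x‖ ^ p.toReal ∂μ := integral_nonneg fun x => by positivity
  rw [Lp.norm_def, (Lp.memLp f).eLpNorm_eq_integral_rpow_norm hp1 hp,
    ENNReal.toReal_ofReal (by positivity), ← Real.rpow_mul h0,
    inv_mul_cancel₀ (ENNReal.toReal_pos hp1 hp).ne', Real.rpow_one]

section Step

variable {ι : Type*} [Fintype ι] {A : ι → Set Ω} (hA : ∀ k, MeasurableSet (A k))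
  (htop : ∀ k, μ (A k) ≠ ∞)

/-- The class in `L_p` of the step function with value `c k` on `A k`. -/
noncomputable def lpStep (p : ℝ≥0∞) (c : ι → Y) : Lp Y p μ :=
  ∑ k, indicatorConstLp p (hA k) (htop k) (c k)

theorem lpStep_coeFn (c : ι → Y) :
    lpStep hA htop p c =ᵐ[μ] fun x => ∑ k, (A k).indicator (fun _ => c k) x := by
  have h (s : Finset ι) : (∑ k ∈ s, indicatorConstLp p (hA k) (htop k) (c k) : Lp Y p μ) =ᵐ[μ]
      fun x => ∑ k ∈ s, (A k).indicator (fun _ => c k) x := by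
    classical
    induction s using Finset.induction_on with
    | empty =>
      filter_upwards [Lp.coeFn_zero Y p μ] with x hx
      simpa using hx
    | insert k s hk ih =>
      rw [Finset.sum_insert hk]
      filter_upwards [ih, Lp.coeFn_add (indicatorConstLp p (hA k) (htop k) (c k))
        (∑ k ∈ s, indicatorConstLp p (hA k) (htop k) (c k)),
        indicatorConstLp_coeFn (p := p) (hs := hA k) (hμs := htop k) (c := c k)] with x h1 h2 h3
      rw [h2, Pi.add_apply, h1, h3, Finset.sum_insert hk]
  exact h Finset.univ

theorem norm_lpStep_rpow [Fact (1 ≤ p)] (hp : p ≠ ∞)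
    (hd : Pairwise fun k l => Disjoint (A k) (A l)) (c : ι → Y) :
    ‖lpStep hA htop p c‖ ^ p.toReal = ∑ k, μ.real (A k) * ‖c k‖ ^ p.toReal := by
  have hp0 : 0 < p.toReal :=
    ENNReal.toReal_pos (zero_lt_one.trans_le (Fact.out : 1 ≤ p)).ne' hp
  rw [lp_norm_rpow_eq_integral hp]
  have h1 : (fun x => ‖lpStep hA htop p c x‖ ^ p.toReal) =ᵐ[μ]
      fun x => ∑ k, (A k).indicator (fun _ => ‖c k‖ ^ p.toReal) x := by
    filter_upwards [lpStep_coeFn (p := p) hA htop c] with x hx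
    rw [hx, map_sum_indicator hd c (fun y => ‖y‖ ^ p.toReal) (by simp [hp0.ne'])]
  rw [integral_congr_ae h1, integral_finsetSum]
  · simp [integral_indicator_const _ (hA _)]
  · exact fun k _ => (integrable_indicator_iff (hA k)).2 (integrableOn_const (htop k))

end Step

variable [NormedSpace ℝ Y]

/-- The average over a set of finite measure, as a linear map on `L_p`. -/
noncomputable def setAverageₗ [Fact (1 ≤ p)] (A : Set Ω) (hA : μ A ≠ ∞) : Lp Y p μ →ₗ[ℝ] Y where
  toFun f := ⨍ x in A, f x ∂μ
  map_add' f g := by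
    rw [setAverage_eq, setAverage_eq, setAverage_eq, ← smul_add,
      ← integral_add (integrableOn_Lp_of_measure_ne_top f Fact.out hA)
        (integrableOn_Lp_of_measure_ne_top g Fact.out hA),
      integral_congr_ae (ae_restrict_of_ae (Lp.coeFn_add f g))]
    rfl
  map_smul' c f := by
    rw [setAverage_eq, setAverage_eq, RingHom.id_apply, smul_comm c, ← integral_smul c,
      integral_congr_ae (ae_restrict_of_ae (Lp.coeFn_smul c f))]
    rfl

theorem setAverageₗ_apply [Fact (1 ≤ p)] (A : Set Ω) (hA : μ A ≠ ∞) (f : Lp Y p μ) :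
    setAverageₗ A hA f = ⨍ x in A, f x ∂μ := rfl

theorem norm_setAverage_sub_le [CompleteSpace Y] {A : Set Ω} (hA0 : μ A ≠ 0) (hA : μ A ≠ ∞)
    {f : Ω → Y} (hf : IntegrableOn f A μ) {c : Y} {r : ℝ}
    (h : ∀ᵐ x ∂μ.restrict A, ‖f x - c‖ ≤ r) : ‖(⨍ x in A, f x ∂μ) - c‖ ≤ r := by
  rw [← dist_eq_norm, ← Metric.mem_closedBall]
  refine (convex_closedBall c r).set_average_mem Metric.isClosed_closedBall hA0 hA ?_ hf
  filter_upwards [h] with x hx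
  rwa [Metric.mem_closedBall, dist_eq_norm]

/-- Multiplication by the indicator function of a measurable set, on `L_∞`. -/
noncomputable def indicatorTop (A : Set Ω) (hA : MeasurableSet A) : Lp Y ∞ μ →L[ℝ] Lp Y ∞ μ :=
  LinearMap.mkContinuous
    { toFun := fun f => ((Lp.memLp f).indicator hA).toLp
      map_add' := fun f g => by
        refine Lp.ext ?_
        filter_upwards [Lp.coeFn_add ((Lp.memLp f).indicator hA).toLp
          ((Lp.memLp g).indicator hA).toLp, Lp.coeFn_add f g,
          ((Lp.memLp f).indicator hA).coeFn_toLp, ((Lp.memLp g).indicator hA).coeFn_toLp,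
          ((Lp.memLp (f + g)).indicator hA).coeFn_toLp] with x h1 h2 h3 h4 h5
        rw [h1, h5, Pi.add_apply, h3, h4]
        by_cases hx : x ∈ A
        · rw [Set.indicator_of_mem hx, Set.indicator_of_mem hx, Set.indicator_of_mem hx, h2,
            Pi.add_apply]
        · simp [hx]
      map_smul' := fun c f => by
        refine Lp.ext ?_
        filter_upwards [Lp.coeFn_smul c ((Lp.memLp f).indicator hA).toLp, Lp.coeFn_smul c f,
          ((Lp.memLp f).indicator hA).coeFn_toLp,
          ((Lp.memLp (c • f)).indicator hA).coeFn_toLp] with x h1 h2 h3 h4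
        rw [RingHom.id_apply, h1, h4, Pi.smul_apply, h3]
        by_cases hx : x ∈ A
        · rw [Set.indicator_of_mem hx, Set.indicator_of_mem hx, h2, Pi.smul_apply]
        · simp [hx] } 1 fun f => by
    rw [one_mul]
    refine norm_top_le_of_ae_bound (norm_nonneg _) ?_
    filter_upwards [((Lp.memLp f).indicator hA).coeFn_toLp, ae_norm_le_norm_top f] with x h1 h2
    refine (congrArg norm h1).trans_le ((norm_indicator_le_norm_self _ _).trans h2)

theorem indicatorTop_coeFn (A : Set Ω) (hA : MeasurableSet A) (f : Lp Y ∞ μ) :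
    indicatorTop A hA f =ᵐ[μ] A.indicator f :=
  ((Lp.memLp f).indicator hA).coeFn_toLp

/-! ### The case of `L_∞` -/

/-- Density of `SAK` passes from `Y` to `L_∞(μ, Y)`. -/
theorem SAKDense.lpTop [CompleteSpace Y] (hY : SAKDense o Y) [SigmaFinite μ] :
    SAKDense o (Lp Y ∞ μ) := by
  have := hY.nontrivial
  rcases eq_or_ne μ 0 with rfl | hμ
  · have : Subsingleton (Lp Y ∞ (0 : Measure Ω)) :=
      ⟨fun f g => Lp.ext (by simp [Filter.EventuallyEq])⟩
    exact .of_subsingleton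
  refine hY.of_localize fun S hS z hz ε hε => ?_
  set δ := ε / 8 with hδ
  have hδ0 : 0 < δ := by positivity
  have hB : MeasurableSet {x | ‖z‖ - δ ≤ ‖z x‖} :=
    measurableSet_le measurable_const (Lp.stronglyMeasurable z).norm.measurable
  have hB0 : μ {x | ‖z‖ - δ ≤ ‖z x‖} ≠ 0 := by
    intro h0
    have hlt : ∀ᵐ x ∂μ, ‖z x‖ < ‖z‖ - δ := by
      rw [ae_iff]
      simpa using h0
    have hpos : 0 ≤ ‖z‖ - δ := by
      have : NeZero μ := ⟨hμ⟩
      obtain ⟨x, hx⟩ := hlt.exists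
      exact (norm_nonneg _).trans hx.le
    have := norm_top_le_of_ae_bound hpos (hlt.mono fun x hx => hx.le)
    linarith
  obtain ⟨t, -, ht, hSt⟩ := hS.finite_cover_balls hδ0
  obtain ⟨A₁, hA₁B, hA₁, hA₁0, hA₁t⟩ := exists_subset_forall_near_const ht hB hB0 hδ0
  -- This is where σ-finiteness enters: `A` needs finite measure so that averages over it are
  -- defined on `L_∞`.
  obtain ⟨A, hA, hAA₁, hA0, hAtop⟩ :=
    μ.exists_subset_measure_lt_top hA₁ (pos_iff_ne_zero.2 hA₁0)
  have hA0 := hA0.ne'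
  have hAtop := hAtop.ne
  have hint (f : Lp Y ∞ μ) : IntegrableOn f A μ :=
    integrableOn_Lp_of_measure_ne_top f Fact.out hAtop
  -- On `A`, `f` is `δ`-close to some `g` of the finite net, which is `δ`-close to a constant `c`.
  -- The average of `f` is then also within `2 * δ` of `c`.
  have hnear : ∀ f ∈ S, ∀ᵐ x ∂μ.restrict A, ‖f x - ⨍ x in A, f x ∂μ‖ ≤ 4 * δ := by
    intro f hf
    obtain ⟨g, hg, hfg⟩ := Set.mem_iUnion₂.1 (hSt hf)
    rw [Metric.mem_ball, dist_eq_norm] at hfg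
    obtain ⟨c, hc⟩ := hA₁t g hg
    have h1 : ∀ᵐ x ∂μ.restrict A, ‖f x - c‖ ≤ 2 * δ := by
      filter_upwards [ae_restrict_of_ae (ae_norm_le_norm_top (f - g)),
        ae_restrict_of_ae (Lp.coeFn_sub f g), ae_restrict_mem hA] with x h1 h2 h3
      rw [h2, Pi.sub_apply] at h1
      have := norm_sub_le_norm_sub_add_norm_sub (f x) (g x) c
      linarith [hc x (hAA₁ h3)]
    have h2 := norm_setAverage_sub_le hA0 hAtop (hint f) h1
    filter_upwards [h1] with x hx
    rw [norm_sub_rev] at h2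
    have := norm_sub_le_norm_sub_add_norm_sub (f x) c (⨍ x in A, f x ∂μ)
    linarith
  -- Gluing keeps `f` off `A` and puts a constant on `A`; `Q` reads `f` by averaging over `A`.
  let R : Lp Y ∞ μ →L[ℝ] Lp Y ∞ μ := indicatorTop Aᶜ hA.compl
  let j : Y →L[ℝ] Lp Y ∞ μ := LinearMap.mkContinuous
    { toFun := fun y => indicatorConstLp ∞ hA hAtop y
      map_add' := fun x y => indicatorConstLp_add.symm
      map_smul' := fun c y => by
        refine Lp.ext ?_
        filter_upwards [Lp.coeFn_smul c (indicatorConstLp ∞ hA hAtop y),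
          indicatorConstLp_coeFn (p := ∞) (hs := hA) (hμs := hAtop) (c := y),
          indicatorConstLp_coeFn (p := ∞) (hs := hA) (hμs := hAtop) (c := c • y)] with x h1 h2 h3
        rw [RingHom.id_apply, h1, h3, Pi.smul_apply, h2]
        by_cases hx : x ∈ A <;> simp [hx] } 1 fun y => by
    rw [one_mul]
    exact (norm_indicatorConstLp_top (hs := hA) (hμs := hAtop) hA0).le
  let Q : Lp Y ∞ μ →L[ℝ] Y := (setAverageₗ A hAtop).mkContinuous 1 fun f => by
    rw [one_mul, setAverageₗ_apply]
    have := norm_setAverage_sub_le hA0 hAtop (hint f) (c := 0) (r := ‖f‖)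
      (by simpa using ae_restrict_of_ae (ae_norm_le_norm_top f))
    simpa using this
  have hQ (f : Lp Y ∞ μ) : Q f = ⨍ x in A, f x ∂μ := rfl
  have hRj (f : Lp Y ∞ μ) (y : Y) :
      ∀ᵐ x ∂μ, (x ∈ A → (R f + j y) x = y) ∧ (x ∉ A → (R f + j y) x = f x) := by
    filter_upwards [Lp.coeFn_add (R f) (j y), indicatorTop_coeFn Aᶜ hA.compl f,
      indicatorConstLp_coeFn (p := ∞) (hs := hA) (hμs := hAtop) (c := y)] with x h1 h2 h3
    have h3 : j y x = A.indicator (fun _ => y) x := h3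
    rw [h1, Pi.add_apply, h2, h3]
    constructor <;> intro hx <;> simp [hx]
  refine ⟨R, j, Q, fun f y => ?_, fun f y => ?_, fun f hf => ?_, ?_⟩
  · refine norm_top_le_of_ae_bound (by positivity) ?_
    filter_upwards [hRj f y, ae_norm_le_norm_top f] with x h1 h2
    by_cases hx : x ∈ A
    · rw [h1.1 hx]; exact le_max_right _ _
    · rw [h1.2 hx]; exact h2.trans (le_max_left _ _)
  · have : (ae (μ.restrict A)).NeBot := by simpa [ae_neBot] using hA0
    obtain ⟨x, hx, h1, h2⟩ := ((ae_restrict_mem hA).and ((ae_restrict_of_ae (hRj f y)).and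
      (ae_restrict_of_ae (ae_norm_le_norm_top (R f + j y))))).exists
    rwa [h1.1 hx] at h2
  · refine norm_top_le_of_ae_bound hε.le ?_
    filter_upwards [hRj f (Q f), Lp.coeFn_sub (R f + j (Q f)) f,
      (ae_restrict_iff' hA).1 (hnear f hf)] with x h1 h2 h3
    rw [h2, Pi.sub_apply]
    by_cases hx : x ∈ A
    · rw [h1.1 hx, norm_sub_rev, hQ]
      linarith [h3 hx]
    · rw [h1.2 hx, sub_self, norm_zero]
      exact hε.le
  · have : (ae (μ.restrict A)).NeBot := by simpa [ae_neBot] using hA0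
    obtain ⟨x, hx, h1⟩ := ((ae_restrict_mem hA).and (hnear z hz)).exists
    have h2 : ‖z‖ - δ ≤ ‖z x‖ := hA₁B (hAA₁ hx)
    rw [hQ]
    linarith [norm_sub_norm_le (z x) (⨍ x in A, z x ∂μ)]

/-! ### The case of `L_p`: averaging onto step functions -/

section Step

variable {ι : Type*} [Fintype ι] {A : ι → Set Ω} (hA : ∀ k, MeasurableSet (A k))
  (htop : ∀ k, μ (A k) ≠ ∞)

theorem setAverage_lpStep [CompleteSpace Y] (hd : Pairwise fun k l => Disjoint (A k) (A l))
    (h0 : ∀ k, μ (A k) ≠ 0) (c : ι → Y) (k : ι) :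
    ⨍ x in A k, lpStep hA htop p c x ∂μ = c k := by
  rw [setAverage_congr_fun (g := fun _ => c k) (hA k), setAverage_const (h0 k) (htop k)]
  filter_upwards [lpStep_coeFn (p := p) hA htop c] with x hx hxk
  rw [hx, Finset.sum_eq_single k _ (by simp), Set.indicator_of_mem hxk]
  exact fun l _ hl => Set.indicator_of_notMem (fun hx => (hd hl).notMem_of_mem_left hx hxk) _

/-- Jensen's inequality for `t ↦ t ^ p`; summed over disjoint sets, it makes averaging onto step
functions contractive. -/
theorem measureReal_mul_norm_setAverage_rpow_le [CompleteSpace Y] [Fact (1 ≤ p)] (hp : p ≠ ∞)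
    {B : Set Ω} (hB0 : μ B ≠ 0) (hB : μ B ≠ ∞) (f : Lp Y p μ) :
    μ.real B * ‖⨍ x in B, f x ∂μ‖ ^ p.toReal ≤ ∫ x in B, ‖f x‖ ^ p.toReal ∂μ := by
  have hp1 : p ≠ 0 := (zero_lt_one.trans_le (Fact.out : 1 ≤ p)).ne'
  have hp1' : 1 ≤ p.toReal := by
    simpa using ENNReal.toReal_mono hp (Fact.out : 1 ≤ p)
  have hB' : 0 < μ.real B := ENNReal.toReal_pos hB0 hB
  have hint := integrableOn_Lp_of_measure_ne_top f Fact.out hB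
  have h1 : ‖⨍ x in B, f x ∂μ‖ ≤ ⨍ x in B, ‖f x‖ ∂μ := by
    rw [setAverage_eq, setAverage_eq, norm_smul, Real.norm_of_nonneg (by positivity), smul_eq_mul]
    gcongr
    exact norm_integral_le_integral_norm _
  have h2 : (⨍ x in B, ‖f x‖ ∂μ) ^ p.toReal ≤ ⨍ x in B, ‖f x‖ ^ p.toReal ∂μ :=
    (convexOn_rpow hp1').map_set_average_le
      (Real.continuous_rpow_const (by positivity)).continuousOn
      isClosed_Ici hB0 hB (.of_forall fun x => norm_nonneg _) hint.norm
      ((Lp.memLp f).integrable_norm_rpow hp1 hp).integrableOn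
  calc μ.real B * ‖⨍ x in B, f x ∂μ‖ ^ p.toReal
      ≤ μ.real B * ⨍ x in B, ‖f x‖ ^ p.toReal ∂μ := by
        gcongr
        exact (Real.rpow_le_rpow (norm_nonneg _) h1 (by positivity)).trans h2
    _ = ∫ x in B, ‖f x‖ ^ p.toReal ∂μ := by
        rw [setAverage_eq, smul_eq_mul, mul_inv_cancel_left₀ hB'.ne']

theorem sum_norm_setAverage_rpow_le [CompleteSpace Y] [Fact (1 ≤ p)] (hp : p ≠ ∞)
    (hA : ∀ k, MeasurableSet (A k)) (htop : ∀ k, μ (A k) ≠ ∞)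
    (hd : Pairwise fun k l => Disjoint (A k) (A l)) (h0 : ∀ k, μ (A k) ≠ 0) (f : Lp Y p μ) :
    ∑ k, μ.real (A k) * ‖⨍ x in A k, f x ∂μ‖ ^ p.toReal ≤ ‖f‖ ^ p.toReal := by
  have hp1 : p ≠ 0 := (zero_lt_one.trans_le (Fact.out : 1 ≤ p)).ne'
  have hint := (Lp.memLp f).integrable_norm_rpow hp1 hp
  rw [lp_norm_rpow_eq_integral hp]
  calc _ ≤ ∑ k, ∫ x in A k, ‖f x‖ ^ p.toReal ∂μ :=
        Finset.sum_le_sum fun k _ => measureReal_mul_norm_setAverage_rpow_le hp (h0 k) (htop k) f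
    _ = ∫ x in ⋃ k ∈ Finset.univ, A k, ‖f x‖ ^ p.toReal ∂μ :=
        (integral_biUnion_finset _ (fun k _ => hA k) (fun k _ l _ h => hd h)
          fun k _ => hint.integrableOn).symm
    _ ≤ _ := setIntegral_le_integral hint (.of_forall fun x => by positivity)

end Step

/-- Bundle the finitely many functions into one `L_p` function with values in `s → Y` and
approximate it by a single simple function: its level sets serve all of `s` at once. -/
theorem exists_lpStep_approx [Fact (1 ≤ p)] (hp : p ≠ ∞) {s : Set (Lp Y p μ)} (hs : s.Finite)
    {ε : ℝ} (hε : 0 < ε) :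
    ∃ (n : ℕ) (A : Fin n → Set Ω) (hA : ∀ k, MeasurableSet (A k)) (htop : ∀ k, μ (A k) ≠ ∞),
      (∀ k, μ (A k) ≠ 0) ∧ (Pairwise fun k l => Disjoint (A k) (A l)) ∧
      ∀ f ∈ s, ∃ c, ‖f - lpStep hA htop p c‖ ≤ ε := by
  classical
  have hp1 : p ≠ 0 := (zero_lt_one.trans_le (Fact.out : 1 ≤ p)).ne'
  have := hs.fintype
  have hg : MemLp (fun x (f : s) => (f : Lp Y p μ) x) p μ := by
    have h1 : MemLp (fun x => ∑ f : s, ContinuousLinearMap.single ℝ (fun _ : s => Y) f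
        ((f : Lp Y p μ) x)) p μ :=
      memLp_finsetSum _ fun f _ => ContinuousLinearMap.comp_memLp' _ (Lp.memLp (f : Lp Y p μ))
    convert h1 using 2 with x
    exact (Finset.univ_sum_single _).symm
  obtain ⟨g, hgε, hgp⟩ := hg.exists_simpleFunc_eLpNorm_sub_lt hp
    (ENNReal.ofReal_pos.2 hε).ne'
  let V := g.range.filter fun v => v ≠ 0 ∧ μ (g ⁻¹' {v}) ≠ 0
  let e := V.equivFin
  have hV (k : Fin V.card) := (Finset.mem_filter.1 (e.symm k).2).2
  let A : Fin V.card → Set Ω := fun k => g ⁻¹' {(e.symm k : s → Y)}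
  have hA (k : Fin V.card) : MeasurableSet (A k) := g.measurableSet_fiber _
  have htop (k : Fin V.card) : μ (A k) ≠ ∞ :=
    (g.measure_preimage_lt_top_of_memLp hp1 hp hgp _ (hV k).1).ne
  have hd : Pairwise fun k l => Disjoint (A k) (A l) := fun k l hkl =>
    Disjoint.preimage _ (Set.disjoint_singleton.2 fun h => hkl (e.symm.injective (Subtype.ext h)))
  refine ⟨V.card, A, hA, htop, fun k => (hV k).2, hd, fun f hf =>
    ⟨fun k => (e.symm k : s → Y) ⟨f, hf⟩, ?_⟩⟩
  have hae : ∀ᵐ x ∂μ, g x = 0 ∨ g x ∈ V := by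
    have : ∀ᵐ x ∂μ, ∀ v ∈ g.range, μ (g ⁻¹' {v}) = 0 → g x ≠ v := by
      refine (Filter.eventually_all_finset _).2 fun v _ => ?_
      by_cases hv : μ (g ⁻¹' {v}) = 0
      · filter_upwards [measure_eq_zero_iff_ae_notMem.1 hv] with x hx _
        exact hx
      · exact .of_forall fun x h => absurd h hv
    filter_upwards [this] with x hx
    by_cases h0 : g x = 0
    · exact .inl h0
    · exact .inr (Finset.mem_filter.2 ⟨g.mem_range_self x, h0, fun h =>
        hx _ (g.mem_range_self x) h rfl⟩)
  have hstep : lpStep hA htop p (fun k => (e.symm k : s → Y) ⟨f, hf⟩) =ᵐ[μ]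
      fun x => g x ⟨f, hf⟩ := by
    filter_upwards [lpStep_coeFn (p := p) hA htop fun k => (e.symm k : s → Y) ⟨f, hf⟩, hae]
      with x hx hgx
    rw [hx]
    rcases hgx with h0 | hxV
    · rw [h0]
      refine Finset.sum_eq_zero fun k _ => Set.indicator_of_notMem (fun hk => (hV k).1 ?_) _
      rw [← h0]
      exact hk.symm
    · have hk : x ∈ A (e ⟨g x, hxV⟩) := by simp [A]
      rw [Finset.sum_eq_single (e ⟨g x, hxV⟩) _ (by simp), Set.indicator_of_mem hk]
      · simp
      · exact fun l _ hl => Set.indicator_of_notMem (fun hx => (hd hl).notMem_of_mem_left hx hk) _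
  rw [Lp.norm_def]
  refine ENNReal.toReal_le_of_le_ofReal hε.le (le_trans ?_ hgε.le)
  refine eLpNorm_mono_ae ?_
  filter_upwards [hstep, Lp.coeFn_sub f (lpStep hA htop p fun k => (e.symm k : s → Y) ⟨f, hf⟩)]
    with x h1 h2
  rw [h2, Pi.sub_apply, h1]
  exact norm_le_pi_norm ((fun f : s => (f : Lp Y p μ) x) - g x) ⟨f, hf⟩

/-- Density of `SAK` passes from `ℓ_p(Y)` to `L_p(μ, Y)`. -/
theorem SAKDense.lp [CompleteSpace Y] [Fact (1 ≤ p)] (hp : p ≠ ∞)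
    (h : SAKDense o (lp (fun _ : ℕ => Y) p)) : SAKDense o (Lp Y p μ) := by
  have := h.nontrivial
  have hp0 : 0 < p.toReal :=
    ENNReal.toReal_pos (zero_lt_one.trans_le (Fact.out : 1 ≤ p)).ne' hp
  refine .of_approx 8 fun F hF ε hε _ => ?_
  obtain ⟨t, -, ht, hFt⟩ := IsCompact.finite_cover_balls hF hε
  obtain ⟨n, A, hA, htop, h0, hd, hstep⟩ := exists_lpStep_approx hp ht hε
  -- These weights are the `L_p` norms of the indicators, so dividing by them makes `i` isometric on
  -- `ℓ_p^n(Y)`.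
  let r : Fin n → ℝ := fun k => μ.real (A k) ^ p.toReal⁻¹
  have hμ (k : Fin n) : 0 < μ.real (A k) := ENNReal.toReal_pos (h0 k) (htop k)
  have hr (k : Fin n) : 0 < r k := Real.rpow_pos_of_pos (hμ k) _
  have hrp (k : Fin n) : r k ^ p.toReal = μ.real (A k) := Real.rpow_inv_rpow (hμ k).le hp0.ne'
  have hW (u : PiLp p fun _ : Fin n => Y) : ‖u‖ ^ p.toReal = ∑ k, ‖u k‖ ^ p.toReal := by
    rw [PiLp.norm_eq_sum hp0, ← Real.rpow_mul (by positivity), one_div,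
      inv_mul_cancel₀ hp0.ne', Real.rpow_one]
  have hi (u : PiLp p fun _ : Fin n => Y) : ‖lpStep hA htop p fun k => (r k)⁻¹ • u k‖ = ‖u‖ := by
    rw [← Real.rpow_left_inj (norm_nonneg _) (norm_nonneg _) hp0.ne', norm_lpStep_rpow _ _ hp hd,
      hW]
    refine Finset.sum_congr rfl fun k _ => ?_
    rw [norm_smul, norm_inv, Real.norm_of_nonneg (hr k).le,
      Real.mul_rpow (by have := hr k; positivity) (norm_nonneg _), Real.inv_rpow (hr k).le, hrp,
      mul_inv_cancel_left₀ (hμ k).ne']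
  let i : (PiLp p fun _ : Fin n => Y) →L[ℝ] Lp Y p μ := LinearMap.mkContinuous
    { toFun := fun u => lpStep hA htop p fun k => (r k)⁻¹ • u k
      map_add' := fun u v => by
        simp only [lpStep, ← Finset.sum_add_distrib, indicatorConstLp_add, PiLp.add_apply, smul_add]
      map_smul' := fun c u => by
        refine Lp.ext ?_
        filter_upwards [Lp.coeFn_smul c (lpStep hA htop p fun k => (r k)⁻¹ • u k),
          lpStep_coeFn (p := p) hA htop fun k => (r k)⁻¹ • u k,
          lpStep_coeFn (p := p) hA htop fun k => (r k)⁻¹ • (c • u) k] with x h1 h2 h3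
        rw [RingHom.id_apply, h1, h3, Pi.smul_apply, h2,
          map_sum_indicator hd _ (fun y => c • y) (smul_zero c)]
        simp only [PiLp.smul_apply, smul_comm c] } 1 fun u => by
    rw [one_mul]
    exact (hi u).le
  let Q : Lp Y p μ →L[ℝ] PiLp p fun _ : Fin n => Y := LinearMap.mkContinuous
    { toFun := fun f => WithLp.toLp p fun k => r k • setAverageₗ (A k) (htop k) f
      map_add' := fun f g => by ext k; simp
      map_smul' := fun c f => by ext k; simp [smul_comm c] } 1 fun f => by
    rw [one_mul, ← Real.rpow_le_rpow_iff (norm_nonneg _) (norm_nonneg _) hp0, hW]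
    refine le_trans (Finset.sum_le_sum fun k _ => ?_)
      (sum_norm_setAverage_rpow_le hp hA htop hd h0 f)
    refine le_of_eq (?_ : ‖r k • ⨍ x in A k, f x ∂μ‖ ^ p.toReal = _)
    rw [norm_smul, Real.norm_of_nonneg (hr k).le, Real.mul_rpow (hr k).le (norm_nonneg _), hrp]
  have hiQ (f : Lp Y p μ) : i (Q f) = lpStep hA htop p fun k => ⨍ x in A k, f x ∂μ := by
    change lpStep hA htop p (fun k => (r k)⁻¹ • r k • ⨍ x in A k, f x ∂μ) = _
    simp only [inv_smul_smul₀ (hr _).ne']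
  have hiQ1 (f : Lp Y p μ) : ‖i (Q f)‖ ≤ ‖f‖ := by
    rw [hiQ, ← Real.rpow_le_rpow_iff (norm_nonneg _) (norm_nonneg _) hp0,
      norm_lpStep_rpow _ _ hp hd]
    exact sum_norm_setAverage_rpow_le hp hA htop hd h0 f
  obtain ⟨G, hG, hFG⟩ := (h.piLp hp n).exists_norm_sub_le_of_factor hF
    -- Each `z` in the image is within `2 * ε` of a step function `g`, which `i ∘ Q` fixes; since `i
    -- ∘ Q` is a contraction, it moves `z` by at most twice that.
    (ε := 4 * ε) (by positivity) i hi Q fun z hz => by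
      obtain ⟨f, hf, hzf⟩ := Set.mem_iUnion₂.1 (hFt (subset_closure hz))
      obtain ⟨c, hc⟩ := hstep f hf
      rw [Metric.mem_ball, dist_eq_norm] at hzf
      set g := lpStep hA htop p c
      have hg : i (Q g) = g := by
        rw [hiQ]
        simp only [g, setAverage_lpStep hA htop hd h0]
      have h1 : ‖z - g‖ ≤ 2 * ε := by
        linarith [norm_sub_le_norm_sub_add_norm_sub z f g]
      have h2 : i (Q z) - z = i (Q (z - g)) - (z - g) := by
        rw [map_sub, map_sub, hg]; abel
      rw [h2]
      linarith [norm_sub_le (i (Q (z - g))) (z - g), hiQ1 (z - g)]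
  exact ⟨G, hG, hFG.trans (by linarith)⟩

end Lp

end PointedLip

theorem mainTheorem12 {M : Type*} [MetricSpace M] [CompleteSpace M] (o : M)
    (Y : Type*) [NormedAddCommGroup Y] [NormedSpace ℝ Y] [CompleteSpace Y]
    (hY : PointedLip.SAKDense o Y) :
    (∀ (K : Type*) [TopologicalSpace K] [CompactSpace K] [T2Space K],
      PointedLip.SAKDense o C(K, Y)) ∧
    (∀ (p : ℝ≥0∞) [Fact (1 ≤ p)], p ≠ ∞ →
      PointedLip.SAKDense o (lp (fun _ : ℕ => Y) p) →
      ∀ (Ω : Type*) [MeasurableSpace Ω] (μ : Measure Ω),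
        PointedLip.SAKDense o (Lp Y p μ)) ∧
    (∀ (Ω : Type*) [MeasurableSpace Ω] (μ : Measure Ω) [SigmaFinite μ],
      PointedLip.SAKDense o (Lp Y ∞ μ)) :=
  ⟨fun K _ _ _ => hY.continuousMap K, fun _ _ hp h _ _ _ => h.lp hp, fun _ _ _ _ => hY.lpTop⟩
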